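/- Let $w_1,\dots,w_p$ be nontrivial elements of the free group $F_2=\langle a,b\rangle$, written as reduced words, let $N\ge 0$ be an integer, and let $\mathrm{Tr}(W_k)$ be the function on $U(N)^2$ that sends $(U,V)$ to the (non-normalized) trace of the matrix obtained from $w_k$ by substituting $(U,V)$ for $(a,b)$. Let $dU$, $dV$ be the normalized Haar measure on $U(N)$. Write $u,u^*,v,v^*$ for the letters $a,a^{-1},b,b^{-1}$. (i) If the total number of occurrences of $u$ in $w_1,\dots,w_p$ differs from that of $u^*$, or the total number of occurrences of $v$ differs from that of $v^*$, then $\iint_{U(N)^2}\mathrm{Tr}(W_1)\cdots\mathrm{Tr}(W_p)\,dU\,dV=0$. (ii) Suppose that $u$ and $u^*$ each occur $n$ times and that $v$ and $v^*$ each occur $m$ times, and that $N>n$ and $N>m$. For $k\in\{n,m\}$ the element $\Phi^N_k=\sum_{\sigma\in S_k}N^{\#\sigma}\sigma$ of $\mathbb C[S_k]$, where $\#\sigma$ is the number of cycles of $\sigma$ (fixed points included), is invertible; let $W^N_\sigma$ denote the coefficient of $\sigma$ in its inverse. Number the occurrences of $u$, $u^*$, $v$, $v^*$ in an arbitrary way,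 thus identifying the set of all letter occurrences with $$X=\{1_u,\dots,n_u,\,1_{u^*},\dots,n_{u^*},\,1_v,\dots,m_v,\,1_{v^*},\dots,m_{v^*}\},$$ and let $\gamma$ be the permutation of $X$ that sends each occurrence to the one following it cyclically in the same word. Then, for all $(U,V)\in U(N)^2$, $\mathrm{Tr}(W_1)\cdots\mathrm{Tr}(W_p)=\mathrm{Tr}_\gamma(U,V)$, where $$\mathrm{Tr}_\gamma(U,V)=\sum_{a:X\to\{1,\dots,N\}}\ \prod_{t=1}^n U_{a(t_u)\,a(\gamma(t_u))}\,(U^*)_{a(t_{u^*})\,a(\gamma(t_{u^*}))}\ \prod_{s=1}^m V_{a(s_v)\,a(\gamma(s_v))}\,(V^*)_{a(s_{v^*})\,a(\gamma(s_{v^*}))},$$ and $$\iint_{U(N)^2}\mathrm{Tr}(W_1)\cdots\mathrm{Tr}(W_p)\,dU\,dV=\sum_{\sigma_u,\theta_u\in S_n}\ \sum_{\sigma_v,\theta_v\in S_m}W^N_{\sigma_u\theta_u^{-1}}\,W^N_{\sigma_v\theta_v^{-1}}\,N^{\#R(\gamma,\sigma_u,\theta_u,\sigma_v,\theta_v)}.$$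 Here $S_n$ permutes the indices of the symbols $t_u$ and $S_m$ those of the symbols $s_v$, and $\#R(\gamma,\sigma_u,\theta_u,\sigma_v,\theta_v)$ is the number of classes of the equivalence relation on $X$ generated by $$t_{u^*}\sim\gamma(\sigma_u(t_u)),\quad \gamma(t_{u^*})\sim\theta_u(t_u)\qquad(1\le t\le n),$$ $$s_{v^*}\sim\gamma(\sigma_v(s_v)),\quad \gamma(s_{v^*})\sim\theta_v(s_v)\qquad(1\le s\le m).$$ -/

import Mathlib

open MeasureTheory

/-! ## The unitary group `U(N)` and its normalised Haar measure -/

/-- The compact group `U(N)`. -/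
abbrev UN (N : ℕ) : Type := Matrix.unitaryGroup (Fin N) ℂ

instance UN.compactSpace (N : ℕ) : CompactSpace (UN N) := by
  refine (isCompact_iff_compactSpace (s := (unitary (Matrix (Fin N) (Fin N) ℂ) : Set (Matrix (Fin N) (Fin N) ℂ)))).mp ?_
  have hK : IsCompact {A : Matrix (Fin N) (Fin N) ℂ |
      ∀ i, A i ∈ {v : Fin N → ℂ | ∀ j, v j ∈ Metric.closedBall (0 : ℂ) 1}} :=
    isCompact_pi_infinite fun _ => isCompact_pi_infinite fun _ => isCompact_closedBall 0 1
  refine hK.of_isClosed_subset (isClosed_unitary (R := Matrix (Fin N) (Fin N) ℂ)) ?_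
  intro A hA i j
  simpa using entry_norm_bound_of_unitary hA i j

/-- `U(N)` carries its Borel sigma-algebra. -/
noncomputable instance UN.measurableSpace (N : ℕ) : MeasurableSpace (UN N) := borel _

instance UN.borelSpace (N : ℕ) : BorelSpace (UN N) := ⟨rfl⟩

/-- The Haar measure of `U(N)`, normalised to total mass `1`. -/
noncomputable def haarUN (N : ℕ) : Measure (UN N) :=
  Measure.haarMeasure (⊤ : TopologicalSpace.PositiveCompacts (UN N))

/-! ## The coefficients `W^N_σ` -/

/-- The number of cycles of a permutation, fixed points included. -/
noncomputable def numCycles {n : ℕ} (σ : Equiv.Perm (Fin n)) : ℕ :=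
  Nat.card (Quotient (Equiv.Perm.SameCycle.setoid σ))

/-- The element `Φ^N = ∑ σ, N ^ #σ • σ` of the group algebra `ℂ[S_n]`. -/
noncomputable def PhiElt (N n : ℕ) : MonoidAlgebra ℂ (Equiv.Perm (Fin n)) :=
  ∑ σ : Equiv.Perm (Fin n), MonoidAlgebra.single σ ((N : ℂ) ^ numCycles σ)

/-- `W^N_σ`: the coefficient of `σ` in the inverse of `Φ^N` in `ℂ[S_n]`
(`Ring.inverse` is the inverse of an invertible element). -/
noncomputable def weingarten (N : ℕ) {n : ℕ} (σ : Equiv.Perm (Fin n)) : ℂ :=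
  (Ring.inverse (PhiElt N n)).coeff σ

/-! ## Words in `F_2` and their letters -/

/-- The value `W(U, V)` of a word `w` in the free group on two generators: substitute `U` for
the first generator and `V` for the second one. -/
noncomputable def wordValue {N : ℕ} (w : FreeGroup (Fin 2)) (x : UN N × UN N) : UN N :=
  FreeGroup.lift ![x.1, x.2] w

/-- The product `Tr(W_1) ⋯ Tr(W_p)` as a function on `U(N)^2`. -/
noncomputable def traceProd {N p : ℕ} (w : Fin p → FreeGroup (Fin 2)) (x : UN N × UN N) : ℂ :=
  ∏ k, Matrix.trace (wordValue (w k) x : Matrix (Fin N) (Fin N) ℂ)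

/-- The letter occurrences in the reduced words `w_1, …, w_p`: pairs (index of a word, position
in its reduced form). -/
abbrev Occ {p : ℕ} (w : Fin p → FreeGroup (Fin 2)) : Type :=
  Σ k : Fin p, Fin (w k).toWord.length

/-- The letter at an occurrence: `(0, true)` is `u`, `(0, false)` is `u*`, `(1, true)` is `v`
and `(1, false)` is `v*`. -/
def Occ.letter {p : ℕ} {w : Fin p → FreeGroup (Fin 2)} (o : Occ w) : Fin 2 × Bool :=
  (w o.1).toWord.get o.2

/-- The occurrence that follows a given one in its own word, read cyclically. -/
def Occ.next {p : ℕ} (w : Fin p → FreeGroup (Fin 2)) : Equiv.Perm (Occ w) :=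
  Equiv.sigmaCongrRight fun k => finRotate (w k).toWord.length

/-- The total number of occurrences of the letter `l` in `w_1, …, w_p`. -/
def letterCount {p : ℕ} (w : Fin p → FreeGroup (Fin 2)) (l : Fin 2 × Bool) : ℕ :=
  Fintype.card {o : Occ w // o.letter = l}

/-- The set of symbols
`X = {1_u, …, n_u, 1_{u*}, …, n_{u*}, 1_v, …, m_v, 1_{v*}, …, m_{v*}}`. -/
abbrev Symb (n m : ℕ) : Type := (Fin n ⊕ Fin n) ⊕ (Fin m ⊕ Fin m)

namespace Symb

variable {n m : ℕ}

/-- The symbol `t_u`. -/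
def u (t : Fin n) : Symb n m := Sum.inl (Sum.inl t)

/-- The symbol `t_{u*}`. -/
def uStar (t : Fin n) : Symb n m := Sum.inl (Sum.inr t)

/-- The symbol `s_v`. -/
def v (s : Fin m) : Symb n m := Sum.inr (Sum.inl s)

/-- The symbol `s_{v*}`. -/
def vStar (s : Fin m) : Symb n m := Sum.inr (Sum.inr s)

/-- The letter that a symbol is an occurrence of. -/
def letter : Symb n m → Fin 2 × Bool
  | Sum.inl (Sum.inl _) => (0, true)
  | Sum.inl (Sum.inr _) => (0, false)
  | Sum.inr (Sum.inl _) => (1, true)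
  | Sum.inr (Sum.inr _) => (1, false)

end Symb

/-- An indexing of the letter occurrences in `w_1, …, w_p` by the symbols of `X`: the
occurrences of `u` are numbered `1_u, …, n_u`, those of `u*` are numbered `1_{u*}, …, n_{u*}`,
and similarly for `v` and `v*`. -/
structure Indexing {p : ℕ} (w : Fin p → FreeGroup (Fin 2)) (n m : ℕ) where
  toEquiv : Symb n m ≃ Occ w
  letter_eq : ∀ x, (toEquiv x).letter = x.letter

/-- Indexings exist as soon as the numbers of occurrences are right. -/
theorem Indexing.nonempty {p : ℕ} (w : Fin p → FreeGroup (Fin 2)) (n m : ℕ)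
    (hu : letterCount w (0, true) = n) (hu' : letterCount w (0, false) = n)
    (hv : letterCount w (1, true) = m) (hv' : letterCount w (1, false) = m) :
    Nonempty (Indexing w n m) := by
  have key : ∀ l : Fin 2 × Bool,
      Fintype.card {x : Symb n m // x.letter = l} = Fintype.card {o : Occ w // o.letter = l} := by
    have h1 : ∀ l : Fin 2 × Bool, Fintype.card {x : Symb n m // x.letter = l} =
        if l.1 = 0 then n else m := by
      rintro ⟨i, b⟩
      rw [Fintype.card_subtype, Finset.card_filter]
      fin_cases i <;> cases b <;>
        simp [Fintype.sum_sum_type, Symb.letter]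
    intro l
    rw [h1]
    obtain ⟨i, b⟩ := l
    fin_cases i <;> cases b
    · exact hu'.symm
    · exact hu.symm
    · exact hv'.symm
    · exact hv.symm
  let e := Equiv.ofFiberEquiv (f := Symb.letter (n := n) (m := m)) (g := Occ.letter (w := w))
    fun l => Fintype.equivOfCardEq (key l)
  exact ⟨⟨e, fun x => Equiv.ofFiberEquiv_map _ x⟩⟩

/-- The word permutation `γ` of `X`: it sends a symbol to the one that follows it cyclically
in its word. -/
def Indexing.gamma {p : ℕ} {w : Fin p → FreeGroup (Fin 2)} {n m : ℕ} (e : Indexing w n m) :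
    Equiv.Perm (Symb n m) :=
  (e.toEquiv.trans (Occ.next w)).trans e.toEquiv.symm

/-- `Tr_γ(U, V)`: the sum over all `a : X → {1, …, N}` of
`∏ u_{a(t_u) a(γ(t_u))} ∏ u*_{a(t_{u*}) a(γ(t_{u*}))} ∏ v_{a(s_v) a(γ(s_v))}
∏ v*_{a(s_{v*}) a(γ(s_{v*}))}`, where `u*_{ij}` and `v*_{ij}` are the entries of the adjoints
of `U` and `V`. -/
noncomputable def traceGamma {N n m : ℕ} (γ : Equiv.Perm (Symb n m)) (x : UN N × UN N) : ℂ :=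
  ∑ a : Symb n m → Fin N,
    (∏ t, (x.1 : Matrix (Fin N) (Fin N) ℂ) (a (Symb.u t)) (a (γ (Symb.u t)))) *
    (∏ t, (star (x.1 : Matrix (Fin N) (Fin N) ℂ)) (a (Symb.uStar t)) (a (γ (Symb.uStar t)))) *
    (∏ s, (x.2 : Matrix (Fin N) (Fin N) ℂ) (a (Symb.v s)) (a (γ (Symb.v s)))) *
    (∏ s, (star (x.2 : Matrix (Fin N) (Fin N) ℂ)) (a (Symb.vStar s)) (a (γ (Symb.vStar s))))

/-! ## The equivalence relation `R(γ, σ_u, θ_u, σ_v, θ_v)` -/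

/-- The generating identifications of `R(γ, σ_u, θ_u, σ_v, θ_v)`. -/
inductive GenRel {n m : ℕ} (γ : Equiv.Perm (Symb n m)) (σu θu : Equiv.Perm (Fin n))
    (σv θv : Equiv.Perm (Fin m)) : Symb n m → Symb n m → Prop
  | u_sigma (t : Fin n) : GenRel γ σu θu σv θv (Symb.uStar t) (γ (Symb.u (σu t)))
  | u_theta (t : Fin n) : GenRel γ σu θu σv θv (γ (Symb.uStar t)) (Symb.u (θu t))
  | v_sigma (s : Fin m) : GenRel γ σu θu σv θv (Symb.vStar s) (γ (Symb.v (σv s)))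
  | v_theta (s : Fin m) : GenRel γ σu θu σv θv (γ (Symb.vStar s)) (Symb.v (θv s))

/-- `#R(γ, σ_u, θ_u, σ_v, θ_v)`: the number of classes of the equivalence relation on `X`
generated by the identifications above. -/
noncomputable def numClasses {n m : ℕ} (γ : Equiv.Perm (Symb n m)) (σu θu : Equiv.Perm (Fin n))
    (σv θv : Equiv.Perm (Fin m)) : ℕ :=
  Nat.card (Quotient (Relation.EqvGen.setoid (GenRel γ σu θu σv θv)))

/-!
Expanding each trace over the letters of its word writes `Tr(W_1) ⋯ Tr(W_p)` as a sum, over the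
functions `a` from letter occurrences to matrix indices, of products of entries of `U`, `U*`, `V`
and `V*` (`traceProd_eq_sum`); numbering the occurrences turns this sum into `Tr_γ`.

If the letter counts are unbalanced, replacing `U` or `V` by its product with a suitable root of
unity preserves the Haar measure and multiplies the integrand by a factor other than `1`, so the
integral vanishes (`integral_traceProd_eq_zero`).

In the balanced case everything reduces to the Weingarten formula `integral_entry_products` for one
Haar unitary matrix. For fixed column indices, the integrals of products of `n` entries and `n`
conjugates of entries form an operator on `(ℂ^N)^{⊗n}` that commutes with every `V^{⊗n}`, by
invariance of the Haar measure. For `n ≤ N` such an operator is a linear combination of the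
permutations of the tensor factors (`CommutesWithUnitaryPowers.exists_eq_sum`). This instance of
Schur–Weyl duality has an elementary proof. Diagonal unitaries show that the operator maps
`e_1 ⊗ ⋯ ⊗ e_n` to a combination of its permutations. After subtracting the corresponding
permutation operators, it remains to see that an element of the commutant that kills
`e_1 ⊗ ⋯ ⊗ e_n` is zero. Permutation matrices reach the other basis tensors with distinct indices,
and collisions are then created one at a time: to turn an index `d` that occurs once into an index
`c` that is already present, apply a reflection of the plane of `e_c` and `e_d`; the wanted tensor is
the only term of the reflected one in which `d` does not occur, so weights single it out.

The coefficients of the combination are found by contracting with a permutation, which reduces the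
integrand to `U* U = 1` and gives a linear system with matrix `N^{#(θτ⁻¹)}`, that is, a convolution
equation for `Φ`. The same matrix is the Gram matrix of the permutation operators, which are
linearly independent for `n ≤ N`; hence `Φ` is invertible (`isUnit_PhiElt`) and the solution is a
convolution with `W` (`eq_sum_weingarten`). Summing over `a`, the deltas of the two Weingarten
formulas select the functions `a` that are constant on the classes of `R`, and there are `N^{#R}` of
them (`card_filter_genRel`).
-/

/-! ### Traces of words as sums over index functions -/

/-- The matrix that a letter stands for: `U`, `U*`, `V` or `V*`. -/
noncomputable def letterMatrix {N : ℕ} (x : UN N × UN N) (l : Fin 2 × Bool) : UN N :=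
  cond l.2 (![x.1, x.2] l.1) (![x.1, x.2] l.1)⁻¹

theorem Matrix.list_ofFn_prod_apply {ι R : Type*} [Fintype ι] [DecidableEq ι] [CommSemiring R]
    {L : ℕ} (M : Fin (L + 1) → Matrix ι ι R) (i j : ι) :
    (List.ofFn M).prod i j =
      ∑ a : Fin L → ι, ∏ k, M k ((Fin.cons i a : Fin (L + 1) → ι) k)
        ((Fin.snoc a j : Fin (L + 1) → ι) k) := by
  induction L generalizing i with
  | zero => simp [Fin.snoc, Fin.cons]
  | succ L ih =>
    rw [List.ofFn_succ, List.prod_cons, Matrix.mul_apply,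
      ← (Fin.consEquiv fun _ : Fin (L + 1) => ι).sum_comp, Fintype.sum_prod_type]
    refine Finset.sum_congr rfl fun b _ => ?_
    rw [ih, Finset.mul_sum]
    refine Finset.sum_congr rfl fun a _ => ?_
    change _ = ∏ k, M k ((Fin.cons i (Fin.cons b a : Fin (L + 1) → ι) : Fin (L + 2) → ι) k)
      ((Fin.snoc (Fin.cons b a : Fin (L + 1) → ι) j : Fin (L + 2) → ι) k)
    rw [Fin.prod_univ_succ (n := L + 1), ← Fin.cons_snoc_eq_snoc_cons]
    simp

theorem Matrix.trace_list_ofFn_prod {ι R : Type*} [Fintype ι] [DecidableEq ι] [CommSemiring R]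
    {L : ℕ} (hL : L ≠ 0) (M : Fin L → Matrix ι ι R) :
    ((List.ofFn M).prod).trace = ∑ a : Fin L → ι, ∏ k, M k (a k) (a (finRotate L k)) := by
  obtain ⟨L, rfl⟩ := Nat.exists_eq_succ_of_ne_zero hL
  rw [← (Fin.consEquiv fun _ : Fin (L + 1) => ι).sum_comp, Fintype.sum_prod_type]
  refine Finset.sum_congr rfl fun i _ => ?_
  rw [Matrix.diag_apply, Matrix.list_ofFn_prod_apply]
  refine Finset.sum_congr rfl fun a _ => Finset.prod_congr rfl fun k _ => ?_
  rw [Fin.snoc_eq_cons_rotate]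
  rfl

theorem coe_wordValue {N : ℕ} (w : FreeGroup (Fin 2)) (x : UN N × UN N) :
    (wordValue w x : Matrix (Fin N) (Fin N) ℂ) =
      (List.ofFn fun k => (letterMatrix x (w.toWord.get k) : Matrix (Fin N) (Fin N) ℂ)).prod := by
  have h : wordValue w x = (List.ofFn fun k => letterMatrix x (w.toWord.get k)).prod := by
    conv_lhs => rw [wordValue, ← FreeGroup.mk_toWord (x := w), FreeGroup.lift_mk]
    rw [List.ofFn_comp' _ (letterMatrix x), List.ofFn_get]
    rfl
  rw [h]
  exact (map_list_prod (Matrix.unitaryGroup (Fin N) ℂ).subtype _).trans (by rw [List.map_ofFn]; rfl)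

/-- The product of traces expands into a sum over all assignments of matrix indices to letter
occurrences; nontriviality of the words is needed because the empty word has trace `N`, while the
empty sum over assignments gives `1`. -/
theorem traceProd_eq_sum {N p : ℕ} (w : Fin p → FreeGroup (Fin 2)) (hw : ∀ k, w k ≠ 1)
    (x : UN N × UN N) :
    traceProd w x = ∑ a : Occ w → Fin N,
      ∏ o, (letterMatrix x o.letter : Matrix (Fin N) (Fin N) ℂ) (a o) (a (Occ.next w o)) := by
  have hL : ∀ k, (w k).toWord.length ≠ 0 := fun k h =>
    hw k (FreeGroup.toWord_eq_nil_iff.mp (List.length_eq_zero_iff.mp h))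
  simp only [traceProd, coe_wordValue, Matrix.trace_list_ofFn_prod (hL _)]
  rw [Finset.prod_univ_sum, Fintype.piFinset_univ,
    ← (Equiv.piCurry fun (k : Fin p) (_ : Fin (w k).toWord.length) => Fin N).sum_comp]
  refine Finset.sum_congr rfl fun a _ => ?_
  rw [Fintype.prod_sigma]
  rfl

theorem traceProd_eq_traceGamma {N p n m : ℕ} (w : Fin p → FreeGroup (Fin 2))
    (hw : ∀ k, w k ≠ 1) (e : Indexing w n m) (x : UN N × UN N) :
    traceProd w x = traceGamma e.gamma x := by
  rw [traceProd_eq_sum w hw, traceGamma, ← (e.toEquiv.arrowCongr (Equiv.refl (Fin N))).sum_comp]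
  refine Finset.sum_congr rfl fun a _ => ?_
  rw [← e.toEquiv.prod_comp]
  simp only [e.letter_eq, Fintype.prod_sum_type, ← mul_assoc]
  simp [Symb.letter, letterMatrix, Symb.u, Symb.uStar, Symb.v, Symb.vStar, Indexing.gamma]

/-! ### The vanishing case -/

/-- The scalar unitary matrix with parameter `z`. -/
def scalarUN (N : ℕ) (z : ℂ) (hz : star z * z = 1) : UN N :=
  ⟨Matrix.diagonal fun _ => z, by
    rw [Matrix.mem_unitaryGroup_iff', Matrix.star_eq_conjTranspose, Matrix.diagonal_conjTranspose,
      Matrix.diagonal_mul_diagonal, ← Matrix.diagonal_one]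
    congr 1
    ext
    exact hz⟩

theorem letterMatrix_scalar_mul {N : ℕ} (d : Fin 2 → ℂ) (hd : ∀ g, star (d g) * d g = 1)
    (x : UN N × UN N) (l : Fin 2 × Bool) :
    (letterMatrix ((scalarUN N (d 0) (hd 0), scalarUN N (d 1) (hd 1)) * x) l :
        Matrix (Fin N) (Fin N) ℂ) =
      cond l.2 (d l.1) (star (d l.1)) • (letterMatrix x l : Matrix (Fin N) (Fin N) ℂ) := by
  have h : ∀ z : ℂ, (Matrix.diagonal fun _ => z : Matrix (Fin N) (Fin N) ℂ) = z • 1 := fun z => by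
    rw [Matrix.smul_one_eq_diagonal]
  obtain ⟨g, b⟩ := l
  fin_cases g <;> cases b <;> simp [letterMatrix, scalarUN, h, Matrix.star_eq_conjTranspose]

theorem traceProd_scalar_mul {N p : ℕ} (w : Fin p → FreeGroup (Fin 2)) (hw : ∀ k, w k ≠ 1)
    (d : Fin 2 → ℂ) (hd : ∀ g, star (d g) * d g = 1) (x : UN N × UN N) :
    traceProd w ((scalarUN N (d 0) (hd 0), scalarUN N (d 1) (hd 1)) * x) =
      (∏ g, d g ^ letterCount w (g, true) * star (d g) ^ letterCount w (g, false)) *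
        traceProd w x := by
  have h : ∏ o : Occ w, cond o.letter.2 (d o.letter.1) (star (d o.letter.1)) =
      ∏ g, d g ^ letterCount w (g, true) * star (d g) ^ letterCount w (g, false) := by
    rw [← Finset.prod_fiberwise (g := Occ.letter), Fintype.prod_prod_type]
    refine Finset.prod_congr rfl fun g _ => ?_
    rw [Fintype.prod_bool]
    congr 1 <;>
    · rw [Finset.prod_congr rfl fun o ho => by rw [(Finset.mem_filter.mp ho).2],
        Finset.prod_const, letterCount, Fintype.card_subtype]
      rfl
  simp only [traceProd_eq_sum w hw, letterMatrix_scalar_mul, Matrix.smul_apply, smul_eq_mul,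
    Finset.prod_mul_distrib, ← Finset.mul_sum, h]

instance UN.secondCountableTopology (N : ℕ) : SecondCountableTopology (UN N) := by
  have : SecondCountableTopology (Matrix (Fin N) (Fin N) ℂ) :=
    inferInstanceAs (SecondCountableTopology (Fin N → Fin N → ℂ))
  exact TopologicalSpace.Subtype.secondCountableTopology _

instance haarUN.isHaarMeasure (N : ℕ) : (haarUN N).IsHaarMeasure :=
  inferInstanceAs (Measure.haarMeasure _).IsHaarMeasure

instance haarUN.isProbabilityMeasure (N : ℕ) : IsProbabilityMeasure (haarUN N) :=
  ⟨by rw [haarUN, ← TopologicalSpace.PositiveCompacts.coe_top]; exact Measure.haarMeasure_self⟩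

/-- Multiplying `U`, or `V`, by a root of unity preserves the Haar measure and multiplies the
product of traces by a factor other than `1`. -/
theorem integral_traceProd_eq_zero {N p : ℕ} (w : Fin p → FreeGroup (Fin 2))
    (hw : ∀ k, w k ≠ 1) (g : Fin 2) (hg : letterCount w (g, true) ≠ letterCount w (g, false)) :
    ∫ x, traceProd w x ∂((haarUN N).prod (haarUN N)) = 0 := by
  set a := letterCount w (g, true)
  set b := letterCount w (g, false)
  obtain ⟨z, hz⟩ : ∃ z : ℂ, IsPrimitiveRoot z (a + b + 1) :=
    ⟨_, Complex.isPrimitiveRoot_exp _ (Nat.succ_ne_zero _)⟩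
  have hzz : star z * z = 1 := by
    rw [Complex.star_def, Complex.conj_mul', hz.norm'_eq_one (Nat.succ_ne_zero _)]
    simp
  let d : Fin 2 → ℂ := Function.update 1 g z
  have hd : ∀ g, star (d g) * d g = 1 := fun g' => by
    by_cases h : g' = g
    · subst h; simpa [d] using hzz
    · simp [d, h]
  have hprod : ∏ g, d g ^ letterCount w (g, true) * star (d g) ^ letterCount w (g, false) =
      z ^ a * star z ^ b := by
    rw [Finset.prod_eq_single g]
    · simp [d, a, b]
    · intro g' _ h
      simp [d, h]
    · simp
  have hint := integral_mul_left_eq_self (μ := (haarUN N).prod (haarUN N)) (traceProd w)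
    (scalarUN N (d 0) (hd 0), scalarUN N (d 1) (hd 1))
  simp only [traceProd_scalar_mul w hw, hprod, integral_const_mul] at hint
  by_contra h0
  have h1 : z ^ a * star z ^ b = 1 := mul_right_cancel₀ h0 (hint.trans (one_mul _).symm)
  have h2 : z ^ a = z ^ b := by
    calc z ^ a = z ^ a * (star z * z) ^ b := by rw [hzz, one_pow, mul_one]
      _ = z ^ a * star z ^ b * z ^ b := by rw [mul_pow, mul_assoc]
      _ = z ^ b := by rw [h1, one_mul]
  exact hg (hz.pow_inj (by omega) (by omega) h2)

/-! ### Tensor powers and their commutant -/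

/-- The tensor power `U^{⊗n}`, as a matrix indexed by multi-indices. -/
def tensorPow {ι : Type*} (n : ℕ) (U : Matrix ι ι ℂ) :
    Matrix (Fin n → ι) (Fin n → ι) ℂ :=
  Matrix.of fun i j => ∏ t, U (i t) (j t)

section TensorPow

variable {ι : Type*} {n : ℕ}

theorem tensorPow_apply (U : Matrix ι ι ℂ) (i j : Fin n → ι) :
    tensorPow n U i j = ∏ t, U (i t) (j t) := rfl

theorem tensorPow_mul [Fintype ι] (U V : Matrix ι ι ℂ) :
    tensorPow n (U * V) = tensorPow n U * tensorPow n V := by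
  ext i j
  simp only [tensorPow_apply, Matrix.mul_apply, Finset.prod_univ_sum, Fintype.piFinset_univ,
    Finset.prod_mul_distrib]

variable [DecidableEq ι]

theorem tensorPow_one : tensorPow n (1 : Matrix ι ι ℂ) = 1 := by
  ext i j
  simp only [tensorPow_apply, Matrix.one_apply, Finset.prod_ite_zero, funext_iff]
  simp

theorem tensorPow_diagonal (d : ι → ℂ) :
    tensorPow n (Matrix.diagonal d) = Matrix.diagonal fun i => ∏ t, d (i t) := by
  ext i j
  simp only [tensorPow_apply, Matrix.diagonal_apply, Finset.prod_ite_zero, funext_iff]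
  simp

/-- The operator by which a permutation of the tensor factors acts on the `n`-th tensor power. -/
def permMatrixTensor (σ : Equiv.Perm (Fin n)) : Matrix (Fin n → ι) (Fin n → ι) ℂ :=
  Matrix.of fun i j => if j = i ∘ σ then 1 else 0

variable [Fintype ι]

theorem permMatrixTensor_comm (σ : Equiv.Perm (Fin n)) (U : Matrix ι ι ℂ) :
    permMatrixTensor σ * tensorPow n U = tensorPow n U * permMatrixTensor σ := by
  ext i j
  have h : ∀ k : Fin n → ι, j = k ∘ σ ↔ k = j ∘ ⇑σ⁻¹ := fun k => by
    constructor <;> rintro rfl <;> ext t <;> simp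
  simp only [Matrix.mul_apply, permMatrixTensor, Matrix.of_apply, tensorPow_apply, h, ite_mul,
    one_mul, zero_mul, mul_ite, mul_one, mul_zero, Finset.sum_ite_eq', Finset.mem_univ, if_true]
  rw [← Equiv.prod_comp σ (fun t => U (i t) ((j ∘ ⇑σ⁻¹) t))]
  simp

/-- Membership in the commutant of the tensor powers of unitary matrices. -/
def CommutesWithUnitaryPowers (B : Matrix (Fin n → ι) (Fin n → ι) ℂ) : Prop :=
  ∀ U ∈ Matrix.unitaryGroup ι ℂ, B * tensorPow n U = tensorPow n U * B

/-- Commuting with the diagonal unitary matrices preserves weights: a nonzero entry joins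
multi-indices in which every value occurs equally often. -/
theorem CommutesWithUnitaryPowers.card_eq {B : Matrix (Fin n → ι) (Fin n → ι) ℂ}
    (hB : CommutesWithUnitaryPowers B) {i j : Fin n → ι} (h : B i j ≠ 0) (d : ι) :
    (Finset.univ.filter fun t => i t = d).card = (Finset.univ.filter fun t => j t = d).card := by
  -- a root of unity of order larger than `n` separates the exponents `0, …, n`
  obtain ⟨z, hz⟩ : ∃ z : ℂ, IsPrimitiveRoot z (n + 1) :=
    ⟨_, Complex.isPrimitiveRoot_exp (n + 1) n.succ_ne_zero⟩
  have hz1 : ‖z‖ = 1 := hz.norm'_eq_one n.succ_ne_zero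
  have hzz : star z * z = 1 := by
    rw [Complex.star_def, Complex.conj_mul', hz1]; simp
  have hU : Matrix.diagonal (fun e => if e = d then z else 1) ∈ Matrix.unitaryGroup ι ℂ := by
    rw [Matrix.mem_unitaryGroup_iff', Matrix.star_eq_conjTranspose, Matrix.diagonal_conjTranspose,
      Matrix.diagonal_mul_diagonal, ← Matrix.diagonal_one]
    congr 1
    ext e
    by_cases he : e = d <;> simp [he]
    simpa using hzz
  have := congrFun (congrFun (hB _ hU) i) j
  rw [tensorPow_diagonal, Matrix.mul_diagonal, Matrix.diagonal_mul, mul_comm] at this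
  have h2 := mul_right_cancel₀ h this
  simp only [Finset.prod_ite, Finset.prod_const, one_pow, mul_one] at h2
  refine (hz.pow_inj ?_ ?_ h2).symm <;>
  · refine Nat.lt_succ_of_le ((Finset.card_le_univ _).trans_eq ?_)
    simp

/-- Permutation matrices carry any injective multi-index to any other. -/
theorem CommutesWithUnitaryPowers.col_eq_zero_of_injective
    {B : Matrix (Fin n → ι) (Fin n → ι) ℂ} (hB : CommutesWithUnitaryPowers B)
    {i₀ i : Fin n → ι} (hi₀ : Function.Injective i₀) (hi : Function.Injective i)
    (h₀ : ∀ r, B r i₀ = 0) (r : Fin n → ι) : B r i = 0 := by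
  obtain ⟨π, hπ⟩ := Equiv.Perm.exists_extending_pair i₀ i hi₀ hi
  have hU : (Matrix.of fun x y => if x = π y then (1 : ℂ) else 0) ∈ Matrix.unitaryGroup ι ℂ := by
    rw [Matrix.mem_unitaryGroup_iff']
    ext x y
    simp [Matrix.mul_apply, Matrix.star_apply, Matrix.one_apply, eq_comm]
  have := congrFun (congrFun (hB _ hU) r) i₀
  simp only [Matrix.mul_apply, h₀, mul_zero, Finset.sum_const_zero, tensorPow_apply,
    Matrix.of_apply, Finset.prod_ite_zero, Finset.prod_const_one, mul_ite, mul_one] at this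
  have h : ∀ k : Fin n → ι, (∀ t, k t = π (i₀ t)) ↔ k = i := by
    intro k
    simp [hπ, funext_iff]
  simpa [h] using this

/-- If the value `c` occurs at `s` in the multi-index `i` and `d` does not occur in `i`, then the
column of `i` is killed as soon as that of `i` with `d` put at `s` is. A reflection `R` of the plane
spanned by the coordinates `c` and `d` maps the second basis tensor to a vector in which the first
one is the only term without `d`, and weights separate it from the others. -/
theorem CommutesWithUnitaryPowers.col_eq_zero_of_update
    {B : Matrix (Fin n → ι) (Fin n → ι) ℂ} (hB : CommutesWithUnitaryPowers B)
    {i : Fin n → ι} {s : Fin n} {d : ι} (hd : ∀ t, i t ≠ d)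
    (h₀ : ∀ r, B r (Function.update i s d) = 0) (r : Fin n → ι) : B r i = 0 := by
  by_contra hr
  set c := i s with hc
  have hcd : c ≠ d := hd s
  -- the reflection along `e_c + 2 e_d`, of squared length `5`; its entries on the plane are nonzero
  let v : ι → ℂ := Pi.single c 1 + Pi.single d 2
  let R : Matrix ι ι ℂ := 1 - (2 / 5 : ℂ) • Matrix.vecMulVec v v
  have hstar : star R = R := by
    ext x y
    have hv : ∀ x, (starRingEnd ℂ) (v x) = v x := fun x => by
      simp only [v, Pi.add_apply, Pi.single_apply]
      split_ifs <;> simp [Complex.conj_ofNat]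
    simp only [R, Matrix.star_apply, Matrix.sub_apply, Matrix.smul_apply, Matrix.vecMulVec_apply,
      Matrix.one_apply]
    by_cases hxy : x = y <;> simp [hxy, hv, eq_comm, mul_comm]
  have hvv : v ⬝ᵥ v = 5 := by
    simp only [v, add_dotProduct, dotProduct_add, single_dotProduct]
    simp [hcd, hcd.symm]
    norm_num
  have hR : R ∈ Matrix.unitaryGroup ι ℂ := by
    rw [Matrix.mem_unitaryGroup_iff', hstar]
    simp only [R, sub_mul, mul_sub, one_mul, mul_one, Matrix.smul_mul, Matrix.mul_smul,
      Matrix.vecMulVec_mul_vecMulVec, hvv, Matrix.vecMulVec_smul, smul_smul]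
    module
  have hvc : v c = 1 := by simp [v, hcd]
  have hvd : v d = 2 := by simp [v, hcd.symm]
  have hvo : ∀ x, x ≠ c → x ≠ d → v x = 0 := fun x h1 h2 => by simp [v, h1, h2]
  have happ : ∀ x y, R x y = (if x = y then 1 else 0) - 2 / 5 * (v x * v y) := fun x y => by
    simp [R, Matrix.one_apply, Matrix.vecMulVec_apply]
  have hsum : ∑ k, B r k * tensorPow n R k (Function.update i s d) = 0 := by
    rw [← Matrix.mul_apply, hB R hR, Matrix.mul_apply]
    simp [h₀]
  have hcount : ∀ k, B r k ≠ 0 → ∀ t, k t ≠ d := by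
    intro k hk t ht
    have h1 := (hB.card_eq hk d).symm.trans (hB.card_eq hr d)
    have h2 : (Finset.univ.filter fun t => i t = d).card = 0 := by simp [hd]
    rw [h2, Finset.card_eq_zero, Finset.filter_eq_empty_iff] at h1
    exact h1 (Finset.mem_univ t) ht
  rw [Finset.sum_eq_single i] at hsum
  · rw [tensorPow_apply] at hsum
    refine mul_ne_zero hr (Finset.prod_ne_zero_iff.mpr fun t _ => ?_) hsum
    by_cases hts : t = s
    · subst hts
      rw [Function.update_self, happ, ← hc, hvc, hvd, if_neg hcd]
      norm_num
    · rw [Function.update_of_ne hts, happ, if_pos rfl]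
      by_cases htc : i t = c
      · rw [htc, hvc]; norm_num
      · rw [hvo _ htc (hd t)]; norm_num
  · intro k _ hki
    by_contra hne
    rw [tensorPow_apply] at hne
    have hk := hcount k (left_ne_zero_of_mul hne)
    have hf := Finset.prod_ne_zero_iff.mp (right_ne_zero_of_mul hne)
    refine hki (funext fun t => ?_)
    have hft := hf t (Finset.mem_univ t)
    by_cases hts : t = s
    · subst hts
      rw [Function.update_self, happ, if_neg (hk t), zero_sub] at hft
      by_contra hkc
      exact hft (by rw [hvo _ hkc (hk t)]; simp)
    · rw [Function.update_of_ne hts, happ] at hft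
      by_contra hkt
      rw [if_neg hkt, zero_sub] at hft
      by_cases htc : i t = c
      · exact hft (by rw [hvo (k t) (fun h => hkt (h.trans htc.symm)) (hk t)]; simp)
      · exact hft (by rw [hvo (i t) htc (hd t)]; simp)
  · simp

/-- An element of the commutant vanishes as soon as it kills one basis tensor with distinct
indices: collisions in a multi-index are removed one at a time, each removal enlarging its image. -/
theorem CommutesWithUnitaryPowers.eq_zero
    {B : Matrix (Fin n → ι) (Fin n → ι) ℂ} (hB : CommutesWithUnitaryPowers B)
    {i₀ : Fin n → ι} (hi₀ : Function.Injective i₀) (h₀ : ∀ r, B r i₀ = 0) : B = 0 := by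
  suffices h : ∀ (m : ℕ) (i : Fin n → ι), n - (Finset.univ.image i).card = m → ∀ r, B r i = 0 by
    ext r i
    exact h _ i rfl r
  intro m
  induction m using Nat.strong_induction_on with
  | _ m ih =>
    intro i hm
    by_cases hi : Function.Injective i
    · exact hB.col_eq_zero_of_injective hi₀ hi h₀
    · have hle : (Finset.univ.image i).card < n := by
        refine lt_of_le_of_ne (Finset.card_image_le.trans_eq (by simp)) fun h => hi ?_
        have := Finset.card_image_iff.mp (h.trans (Finset.card_fin n).symm)
        simpa [Set.injOn_univ] using this
      have hn : n ≤ Fintype.card ι := by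
        simpa using Fintype.card_le_of_injective i₀ hi₀
      obtain ⟨d, hd⟩ : ∃ d, d ∉ Finset.univ.image i := by
        by_contra! h
        rw [Finset.eq_univ_iff_forall.mpr h, Finset.card_univ] at hle
        omega
      have hd' : ∀ t, i t ≠ d := fun t ht => hd (Finset.mem_image.mpr ⟨t, Finset.mem_univ t, ht⟩)
      obtain ⟨s, t, hst, hne⟩ : ∃ s t, i s = i t ∧ s ≠ t := by
        simpa [Function.Injective] using hi
      have himage : insert d (Finset.univ.image i) ⊆
          Finset.univ.image (Function.update i s d) := by
        intro x hx
        rw [Finset.mem_insert, Finset.mem_image] at hx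
        rw [Finset.mem_image]
        rcases hx with rfl | ⟨q, -, rfl⟩
        · exact ⟨s, Finset.mem_univ _, Function.update_self ..⟩
        · by_cases hq : q = s
          · exact ⟨t, Finset.mem_univ _, by rw [Function.update_of_ne hne.symm, hq, hst]⟩
          · exact ⟨q, Finset.mem_univ _, Function.update_of_ne hq ..⟩
      have hcard := Finset.card_le_card himage
      rw [Finset.card_insert_of_notMem hd] at hcard
      exact hB.col_eq_zero_of_update hd' (s := s) (ih _ (by omega) _ rfl)

/-- **Schur–Weyl duality** in the range `n ≤ N`: the commutant of the tensor powers of unitary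
matrices is spanned by the permutations of the tensor factors. -/
theorem CommutesWithUnitaryPowers.exists_eq_sum
    {A : Matrix (Fin n → ι) (Fin n → ι) ℂ} (hA : CommutesWithUnitaryPowers A)
    (hn : n ≤ Fintype.card ι) :
    ∃ c : Equiv.Perm (Fin n) → ℂ, A = ∑ σ, c σ • permMatrixTensor σ := by
  obtain ⟨i₀⟩ : Nonempty (Fin n ↪ ι) := Function.Embedding.nonempty_of_card_le (by simpa using hn)
  have hi₀ := i₀.injective
  have hinj : ∀ σ τ : Equiv.Perm (Fin n), i₀ ∘ σ = i₀ ∘ τ → σ = τ := fun σ τ h =>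
    Equiv.ext fun t => hi₀ (congrFun h t)
  -- the coefficients are read off from the image of the basis tensor `i₀`
  refine ⟨fun σ => A (i₀ ∘ ⇑σ⁻¹) i₀, sub_eq_zero.mp ?_⟩
  refine CommutesWithUnitaryPowers.eq_zero (i₀ := i₀) ?_ hi₀ fun r => ?_
  · intro U hU
    simp only [sub_mul, mul_sub, Finset.sum_mul, Finset.mul_sum, Matrix.smul_mul, Matrix.mul_smul,
      permMatrixTensor_comm, hA U hU]
  · rw [Matrix.sub_apply, Matrix.sum_apply]
    have hper : ∀ σ : Equiv.Perm (Fin n), i₀ = r ∘ σ ↔ r = i₀ ∘ ⇑σ⁻¹ := fun σ => by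
      constructor
      · intro h; ext t; simp [h]
      · rintro rfl; ext t; simp
    simp only [Matrix.smul_apply, permMatrixTensor, Matrix.of_apply, hper, smul_eq_mul, mul_ite,
      mul_one, mul_zero]
    by_cases hr : ∃ τ : Equiv.Perm (Fin n), r = i₀ ∘ ⇑τ⁻¹
    · obtain ⟨τ, rfl⟩ := hr
      rw [Finset.sum_eq_single τ]
      · simp
      · intro σ _ hσ
        rw [if_neg fun h => hσ (inv_injective (hinj _ _ h)).symm]
      · simp
    · push Not at hr
      simp only [hr, if_false, Finset.sum_const_zero, sub_zero]
      -- by weights, a row with a nonzero entry takes each value of `i₀` exactly once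
      by_contra hne
      have hcount := hA.card_eq hne
      have hmem : ∀ t, ∃ s, r s = i₀ t := fun t => by
        have h1 : 0 < (Finset.univ.filter fun s => i₀ s = i₀ t).card :=
          Finset.card_pos.mpr ⟨t, by simp⟩
        rw [← hcount] at h1
        obtain ⟨s, hs⟩ := Finset.card_pos.mp h1
        exact ⟨s, by simpa using hs⟩
      choose f hf using hmem
      have hfi : Function.Injective f := fun s t h => hi₀ (by rw [← hf s, ← hf t, h])
      refine hr (Equiv.ofBijective f (Finite.injective_iff_bijective.mp hfi)) (funext fun t => ?_)
      rw [Function.comp_apply, ← hf]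
      congr 1
      exact ((Equiv.ofBijective f _).apply_symm_apply t).symm

end TensorPow

/-! ### Invertibility of `Φ` -/

theorem natCard_fun_subtype_setoid {X : Type*} [Finite X] (N : ℕ) (r : Setoid X) :
    Nat.card {a : X → Fin N // ∀ x y, r x y → a x = a y} = N ^ Nat.card (Quotient r) := by
  have e : {a : X → Fin N // ∀ x y, r x y → a x = a y} ≃ (Quotient r → Fin N) :=
    (Equiv.subtypeEquivRight fun a => by
      rw [Setoid.le_def]; rfl).trans
      (Setoid.liftEquiv r)
  rw [Nat.card_congr e, Nat.card_fun, Nat.card_fin]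

/-- Multi-indices fixed by a permutation are those that are constant on its cycles. -/
theorem card_filter_comp_perm_eq {n : ℕ} (N : ℕ) (σ : Equiv.Perm (Fin n)) :
    (Finset.univ.filter fun i : Fin n → Fin N => i ∘ σ = i).card = N ^ numCycles σ := by
  rw [numCycles, ← natCard_fun_subtype_setoid, ← Fintype.card_subtype, ← Nat.card_eq_fintype_card]
  refine Nat.card_congr (Equiv.subtypeEquivRight fun a => ?_)
  constructor
  · rintro h x y ⟨k, rfl⟩
    have hz : ∀ (k : ℤ) (x : Fin n), a ((σ ^ k) x) = a x := by
      intro k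
      induction k using Int.induction_on with
      | zero => simp
      | succ k ih => intro x; rw [zpow_add_one, Equiv.Perm.mul_apply, ih]; exact congrFun h x
      | pred k ih =>
        intro x
        rw [zpow_sub_one, Equiv.Perm.mul_apply, ih, ← congrFun h, Function.comp_apply,
          ← Equiv.Perm.mul_apply, mul_inv_cancel, Equiv.Perm.one_apply]
    exact (hz k x).symm
  · exact fun h => funext fun t => (h t (σ t) (Equiv.Perm.sameCycle_apply_right.mpr .rfl)).symm

theorem PhiElt_coeff (N n : ℕ) (τ : Equiv.Perm (Fin n)) :
    (PhiElt N n).coeff τ = (N : ℂ) ^ numCycles τ := by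
  rw [PhiElt, MonoidAlgebra.coeff_sum, Finsupp.finsetSum_apply, Finset.sum_eq_single τ]
  · simp
  · intro σ _ h
    simp [h]
  · simp

theorem MonoidAlgebra.coeff_mul_eq_sum {k G : Type*} [Semiring k] [Group G] [Fintype G]
    (x y : MonoidAlgebra k G) (g : G) :
    (x * y).coeff g = ∑ h, x.coeff h * y.coeff (h⁻¹ * g) := by
  rw [MonoidAlgebra.coeff_mul_apply_left, Finsupp.sum_fintype]
  simp

/-- The matrix whose columns are the permutation operators, read as vectors of the tensor power
of degree `2n`. -/
def permColumns (N n : ℕ) :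
    Matrix ((Fin n → Fin N) × (Fin n → Fin N)) (Equiv.Perm (Fin n)) ℂ :=
  Matrix.of fun x h => if x.2 = x.1 ∘ ⇑h⁻¹ then 1 else 0

/-- The coefficients of `Φ` are the inner products of the permutation operators. -/
theorem conjTranspose_permColumns_mul (N n : ℕ) (τ h : Equiv.Perm (Fin n)) :
    ((permColumns N n).conjTranspose * permColumns N n) τ h = (PhiElt N n).coeff (h⁻¹ * τ) := by
  have hi : ∀ i : Fin n → Fin N, i ∘ ⇑h⁻¹ = i ∘ ⇑τ⁻¹ ↔ i ∘ ⇑(h⁻¹ * τ) = i := by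
    intro i
    constructor <;> intro hh <;> ext t
    · have := congrFun hh (τ t)
      simp_all
    · have := congrFun hh (τ⁻¹ t)
      simp_all
  rw [PhiElt_coeff, ← Nat.cast_pow, ← card_filter_comp_perm_eq, Matrix.mul_apply,
    Fintype.sum_prod_type, Finset.card_filter, Nat.cast_sum]
  refine Finset.sum_congr rfl fun i _ => ?_
  have hi' := hi i
  simp only [permColumns, Matrix.conjTranspose_apply, Matrix.of_apply, ← hi', eq_comm, apply_ite star,
    star_one, star_zero, mul_ite, mul_one, mul_zero]
  simp [eq_comm]

/-- For `n ≤ N` the permutation operators are linearly independent, which makes their Gram matrix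
nonsingular. -/
theorem isUnit_PhiElt {N n : ℕ} (hn : n ≤ N) : IsUnit (PhiElt N n) := by
  have : IsArtinianRing (MonoidAlgebra ℂ (Equiv.Perm (Fin n))) := IsArtinianRing.of_finite ℂ _
  rw [IsArtinianRing.isUnit_iff_isRightRegular, isRightRegular_iff_left_eq_zero_of_mul]
  intro y hy
  have hG : ((permColumns N n).conjTranspose * permColumns N n).mulVec y.coeff = 0 := by
    ext τ
    have := congrArg (fun z => z.coeff τ) hy
    simp only [MonoidAlgebra.coeff_mul_eq_sum] at this
    simpa [Matrix.mulVec, dotProduct, conjTranspose_permColumns_mul, mul_comm] using this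
  open ComplexOrder in rw [Matrix.conjTranspose_mul_self_mulVec_eq_zero] at hG
  ext τ
  -- the row at a pair of injective multi-indices that differ by `τ` isolates the coefficient of `τ`
  have hτ := congrFun hG (Fin.castLE hn, Fin.castLE hn ∘ ⇑τ⁻¹)
  have hinj : ∀ h : Equiv.Perm (Fin n),
      Fin.castLE hn ∘ ⇑τ⁻¹ = Fin.castLE hn ∘ ⇑h⁻¹ ↔ τ = h := fun h => by
    rw [(Fin.castLE_injective hn).comp_left.eq_iff, DFunLike.coe_fn_eq, inv_inj]
  simp only [Matrix.mulVec, dotProduct, permColumns, Matrix.of_apply, hinj, ite_mul, one_mul,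
    zero_mul, Finset.sum_ite_eq, Finset.mem_univ, if_true] at hτ
  exact hτ

/-- The equations that determine the Weingarten coefficients: a function `c` whose pairing with the
rows of the Gram matrix gives `δ` is a convolution of `δ` with `W`. -/
theorem eq_sum_weingarten {N n : ℕ} (hn : n ≤ N) (c δ : Equiv.Perm (Fin n) → ℂ)
    (h : ∀ τ, ∑ θ, c θ * (N : ℂ) ^ numCycles (θ * τ⁻¹) = δ τ) (θ : Equiv.Perm (Fin n)) :
    c θ = ∑ σ, weingarten N (σ * θ⁻¹) * δ σ := by
  -- read at inverse permutations, the system is the equation `y * Φ = x` in the group algebra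
  let y : MonoidAlgebra ℂ (Equiv.Perm (Fin n)) :=
    .ofCoeff (Finsupp.equivFunOnFinite.symm fun x => c x⁻¹)
  let x : MonoidAlgebra ℂ (Equiv.Perm (Fin n)) :=
    .ofCoeff (Finsupp.equivFunOnFinite.symm fun x => δ x⁻¹)
  have hyx : y * PhiElt N n = x := by
    ext τ
    rw [MonoidAlgebra.coeff_mul_eq_sum, ← Equiv.sum_comp (Equiv.inv (Equiv.Perm (Fin n)))]
    simpa [x, y, PhiElt_coeff] using h τ⁻¹
  have hy : y = x * Ring.inverse (PhiElt N n) := by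
    rw [← hyx, Ring.mul_inverse_cancel_right _ _ (isUnit_PhiElt hn)]
  have := congrArg (fun z => z.coeff θ⁻¹) hy
  simp only [MonoidAlgebra.coeff_mul_eq_sum] at this
  rw [← Equiv.sum_comp (Equiv.inv (Equiv.Perm (Fin n)))] at this
  simpa [x, y, weingarten, mul_comm] using this

/-! ### Integrals of products of matrix entries -/

theorem UN.continuous_entry {N : ℕ} (i j : Fin N) :
    Continuous fun U : UN N => (U : Matrix (Fin N) (Fin N) ℂ) i j :=
  continuous_subtype_val.matrix_elem i j

theorem integrable_haarUN_of_continuous {N : ℕ} {f : UN N → ℂ} (hf : Continuous f) :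
    Integrable f (haarUN N) :=
  hf.integrable_of_hasCompactSupport (HasCompactSupport.of_compactSpace f)

theorem continuous_entry_products {N n : ℕ} (i j i' j' : Fin n → Fin N) :
    Continuous fun U : UN N => (∏ t, (U : Matrix (Fin N) (Fin N) ℂ) (i t) (j t)) *
      ∏ t, star ((U : Matrix (Fin N) (Fin N) ℂ) (i' t) (j' t)) :=
  (continuous_finsetProd _ fun _ _ => UN.continuous_entry _ _).mul
    (continuous_finsetProd _ fun _ _ => continuous_star.comp (UN.continuous_entry _ _))

theorem tensorPow_conjTranspose {ι : Type*} {n : ℕ} (U : Matrix ι ι ℂ) :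
    tensorPow n U.conjTranspose = (tensorPow n U).conjTranspose := by
  ext i j
  simp [tensorPow_apply, Matrix.conjTranspose_apply]

/-- The integrals of products of entries, as a matrix in the two row multi-indices. -/
noncomputable def entryIntegral {N n : ℕ} (j j' : Fin n → Fin N) :
    Matrix (Fin n → Fin N) (Fin n → Fin N) ℂ :=
  Matrix.of fun i i' => ∫ U : UN N, (∏ t, (U : Matrix (Fin N) (Fin N) ℂ) (i t) (j t)) *
    ∏ t, star ((U : Matrix (Fin N) (Fin N) ℂ) (i' t) (j' t)) ∂haarUN N

/-- By left invariance of the Haar measure, the integrals of products of entries form an element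
of the commutant. -/
theorem entryIntegral_commutes {N n : ℕ} (j j' : Fin n → Fin N) :
    CommutesWithUnitaryPowers (entryIntegral j j') := by
  intro V hV
  have hVV : (tensorPow n V).conjTranspose * tensorPow n V = 1 := by
    rw [← tensorPow_conjTranspose, ← tensorPow_mul, ← Matrix.star_eq_conjTranspose,
      Matrix.mem_unitaryGroup_iff'.mp hV, tensorPow_one]
  have hinv : tensorPow n V * entryIntegral j j' * (tensorPow n V).conjTranspose =
      entryIntegral j j' := by
    ext i i'
    conv_rhs => rw [entryIntegral, Matrix.of_apply, ← integral_mul_left_eq_self _ (⟨V, hV⟩ : UN N)]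
    have hexp : ∀ U : UN N,
        (∏ t, ((⟨V, hV⟩ * U : UN N) : Matrix (Fin N) (Fin N) ℂ) (i t) (j t)) *
          ∏ t, star (((⟨V, hV⟩ * U : UN N) : Matrix (Fin N) (Fin N) ℂ) (i' t) (j' t)) =
        ∑ k', ∑ k, tensorPow n V i k * star (tensorPow n V i' k') *
          ((∏ t, (U : Matrix (Fin N) (Fin N) ℂ) (k t) (j t)) *
            ∏ t, star ((U : Matrix (Fin N) (Fin N) ℂ) (k' t) (j' t))) := by
      intro U
      have h := tensorPow_mul (n := n) V (U : Matrix (Fin N) (Fin N) ℂ)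
      have h1 := congrFun (congrFun h i) j
      have h2 := congrArg star (congrFun (congrFun h i') j')
      simp only [Matrix.mul_apply (M := tensorPow n V), star_sum, star_mul'] at h1 h2
      rw [tensorPow_apply] at h1 h2
      rw [star_prod] at h2
      change (∏ t, (V * (U : Matrix (Fin N) (Fin N) ℂ)) (i t) (j t)) *
          ∏ t, star ((V * (U : Matrix (Fin N) (Fin N) ℂ)) (i' t) (j' t)) = _
      rw [h1, h2, Finset.sum_mul_sum, Finset.sum_comm]
      refine Finset.sum_congr rfl fun k' _ => Finset.sum_congr rfl fun k _ => ?_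
      rw [tensorPow_apply (U : Matrix (Fin N) (Fin N) ℂ),
        tensorPow_apply (U : Matrix (Fin N) (Fin N) ℂ), star_prod]
      ring
    have hI : ∀ k k' : Fin n → Fin N, Integrable (fun U : UN N =>
        tensorPow n V i k * star (tensorPow n V i' k') *
          ((∏ t, (U : Matrix (Fin N) (Fin N) ℂ) (k t) (j t)) *
            ∏ t, star ((U : Matrix (Fin N) (Fin N) ℂ) (k' t) (j' t)))) (haarUN N) := fun k k' =>
      (integrable_haarUN_of_continuous (continuous_entry_products k j k' j')).const_mul _
    simp only [hexp]
    rw [integral_finsetSum _ fun k' _ => integrable_finsetSum _ fun k _ => hI k k']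
    simp only [Matrix.mul_apply, Finset.sum_mul]
    refine Finset.sum_congr rfl fun k' _ => ?_
    rw [integral_finsetSum _ fun k _ => hI k k']
    refine Finset.sum_congr rfl fun k _ => ?_
    rw [integral_const_mul, entryIntegral, Matrix.of_apply, Matrix.conjTranspose_apply]
    ring
  calc entryIntegral j j' * tensorPow n V
      = tensorPow n V * entryIntegral j j' * (tensorPow n V).conjTranspose * tensorPow n V := by
        rw [hinv]
    _ = tensorPow n V * entryIntegral j j' := by rw [Matrix.mul_assoc, hVV, Matrix.mul_one]

/-- Contracting the row multi-indices along a permutation leaves the entries of `U* U = 1`. -/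
theorem sum_entryIntegral_comp {N n : ℕ} (j j' : Fin n → Fin N) (τ : Equiv.Perm (Fin n)) :
    ∑ i, entryIntegral j j' i (i ∘ τ) = if j' = j ∘ τ then 1 else 0 := by
  have hint : ∀ i, Integrable (fun U : UN N =>
      (∏ t, (U : Matrix (Fin N) (Fin N) ℂ) (i t) (j t)) *
        ∏ t, star ((U : Matrix (Fin N) (Fin N) ℂ) ((i ∘ τ) t) (j' t))) (haarUN N) := fun i =>
    integrable_haarUN_of_continuous (continuous_entry_products _ _ _ _)
  simp only [entryIntegral, Matrix.of_apply]
  rw [← integral_finsetSum _ fun i _ => hint i]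
  have h : ∀ U : UN N, ∑ i : Fin n → Fin N, (∏ t, (U : Matrix (Fin N) (Fin N) ℂ) (i t) (j t)) *
        ∏ t, star ((U : Matrix (Fin N) (Fin N) ℂ) ((i ∘ τ) t) (j' t)) =
      if j' = j ∘ τ then 1 else 0 := by
    intro U
    have hU := tensorPow_mul (n := n) (U : Matrix (Fin N) (Fin N) ℂ).conjTranspose U
    rw [← Matrix.star_eq_conjTranspose, Matrix.mem_unitaryGroup_iff'.mp U.2, tensorPow_one] at hU
    have hU' := congrFun (congrFun hU (j' ∘ ⇑τ⁻¹)) j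
    have hj : j' ∘ ⇑τ⁻¹ = j ↔ j' = j ∘ τ := by
      constructor
      · rintro rfl; ext t; simp
      · rintro rfl; ext t; simp
    rw [Matrix.one_apply, Matrix.mul_apply] at hU'
    simp only [hj] at hU'
    rw [hU']
    refine Finset.sum_congr rfl fun i _ => ?_
    rw [mul_comm, tensorPow_apply, tensorPow_apply,
      ← Equiv.prod_comp τ fun t => star (U : Matrix (Fin N) (Fin N) ℂ) ((j' ∘ ⇑τ⁻¹) t) (i t)]
    simp [Matrix.star_apply]
  simp only [h]
  simp

/-- The **Weingarten formula** for the integral of a product of entries of a Haar-distributed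
unitary matrix and of their conjugates. -/
theorem integral_entry_products {N n : ℕ} (hn : n ≤ N) (i j i' j' : Fin n → Fin N) :
    ∫ U : UN N, (∏ t, (U : Matrix (Fin N) (Fin N) ℂ) (i t) (j t)) *
        ∏ t, star ((U : Matrix (Fin N) (Fin N) ℂ) (i' t) (j' t)) ∂haarUN N =
      ∑ σ : Equiv.Perm (Fin n), ∑ θ : Equiv.Perm (Fin n),
        weingarten N (σ * θ⁻¹) * if j' = j ∘ σ ∧ i' = i ∘ θ then 1 else 0 := by
  obtain ⟨c, hc⟩ := (entryIntegral_commutes j j').exists_eq_sum (by simpa using hn)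
  have hc' : ∀ i i', entryIntegral j j' i i' = ∑ θ : Equiv.Perm (Fin n),
      c θ * if i' = i ∘ θ then 1 else 0 := fun i i' => by
    rw [hc, Matrix.sum_apply]
    rfl
  have hδ : ∀ τ : Equiv.Perm (Fin n), ∑ θ, c θ * (N : ℂ) ^ numCycles (θ * τ⁻¹) =
      if j' = j ∘ τ then 1 else 0 := by
    intro τ
    rw [← sum_entryIntegral_comp]
    simp only [hc']
    rw [Finset.sum_comm]
    refine Finset.sum_congr rfl fun θ _ => ?_
    rw [← Finset.mul_sum, ← Nat.cast_pow, ← card_filter_comp_perm_eq, Finset.card_filter,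
      Nat.cast_sum]
    congr 1
    refine Finset.sum_congr rfl fun i _ => ?_
    have : i ∘ ⇑(θ * τ⁻¹) = i ↔ i ∘ ⇑τ = i ∘ ⇑θ := by
      constructor <;> intro hh <;> ext t
      · have := congrFun hh (τ t)
        simp_all
      · have := congrFun hh (τ⁻¹ t)
        simp_all
    simp only [this]
    push_cast
    rfl
  refine (hc' i i').trans ?_
  rw [Finset.sum_comm]
  refine Finset.sum_congr rfl fun θ _ => ?_
  rw [eq_sum_weingarten hn c _ hδ θ, Finset.sum_mul]
  refine Finset.sum_congr rfl fun σ _ => ?_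
  rw [mul_assoc, ite_and, ite_mul, one_mul, zero_mul]

/-! ### The integral of a product of traces -/

/-- The index functions selected by the Weingarten formula are those that are constant on the
classes of `R(γ, σ_u, θ_u, σ_v, θ_v)`. -/
theorem card_filter_genRel {N n m : ℕ} (γ : Equiv.Perm (Symb n m)) (σu θu : Equiv.Perm (Fin n))
    (σv θv : Equiv.Perm (Fin m)) :
    (Finset.univ.filter fun a : Symb n m → Fin N =>
      ((a ∘ Symb.uStar = (a ∘ γ ∘ Symb.u) ∘ σu) ∧ (a ∘ γ ∘ Symb.uStar = (a ∘ Symb.u) ∘ θu)) ∧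
      ((a ∘ Symb.vStar = (a ∘ γ ∘ Symb.v) ∘ σv) ∧ (a ∘ γ ∘ Symb.vStar = (a ∘ Symb.v) ∘ θv))).card =
      N ^ numClasses γ σu θu σv θv := by
  rw [numClasses, ← natCard_fun_subtype_setoid, ← Fintype.card_subtype, ← Nat.card_eq_fintype_card]
  refine Nat.card_congr (Equiv.subtypeEquivRight fun a => ?_)
  constructor
  · rintro ⟨⟨h1, h2⟩, h3, h4⟩ x y hxy
    induction hxy with
    | rel x y h =>
      cases h with
      | u_sigma t => exact congrFun h1 t
      | u_theta t => exact congrFun h2 t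
      | v_sigma t => exact congrFun h3 t
      | v_theta t => exact congrFun h4 t
    | refl x => rfl
    | symm x y _ ih => exact ih.symm
    | trans x y z _ _ ih₁ ih₂ => exact ih₁.trans ih₂
  · intro h
    have hr : ∀ {x y}, GenRel γ σu θu σv θv x y → a x = a y := fun hxy => h _ _ (.rel _ _ hxy)
    exact ⟨⟨funext fun t => hr (.u_sigma t), funext fun t => hr (.u_theta t)⟩,
      funext fun s => hr (.v_sigma s), funext fun s => hr (.v_theta s)⟩

theorem integral_traceGamma {N n m : ℕ} (hn : n ≤ N) (hm : m ≤ N) (γ : Equiv.Perm (Symb n m)) :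
    ∫ x, traceGamma γ x ∂((haarUN N).prod (haarUN N)) =
      ∑ σu : Equiv.Perm (Fin n), ∑ θu : Equiv.Perm (Fin n),
      ∑ σv : Equiv.Perm (Fin m), ∑ θv : Equiv.Perm (Fin m),
        weingarten N (σu * θu⁻¹) * weingarten N (σv * θv⁻¹) *
          (N : ℂ) ^ numClasses γ σu θu σv θv := by
  let f (k : ℕ) (i j i' j' : Fin k → Fin N) (U : UN N) : ℂ :=
    (∏ t, (U : Matrix (Fin N) (Fin N) ℂ) (i t) (j t)) *
      ∏ t, star ((U : Matrix (Fin N) (Fin N) ℂ) (i' t) (j' t))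
  have htr : ∀ x : UN N × UN N, traceGamma γ x = ∑ a : Symb n m → Fin N,
      f n (a ∘ Symb.u) (a ∘ γ ∘ Symb.u) (a ∘ γ ∘ Symb.uStar) (a ∘ Symb.uStar) x.1 *
        f m (a ∘ Symb.v) (a ∘ γ ∘ Symb.v) (a ∘ γ ∘ Symb.vStar) (a ∘ Symb.vStar) x.2 := by
    intro x
    refine Finset.sum_congr rfl fun a _ => ?_
    simp only [f, Matrix.star_apply, Function.comp_apply, mul_assoc]
  have hf : ∀ k (i j i' j' : Fin k → Fin N), Integrable (f k i j i' j') (haarUN N) :=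
    fun k i j i' j' => integrable_haarUN_of_continuous (continuous_entry_products i j i' j')
  have hprod : ∀ a : Symb n m → Fin N, ∫ x : UN N × UN N,
      f n (a ∘ Symb.u) (a ∘ γ ∘ Symb.u) (a ∘ γ ∘ Symb.uStar) (a ∘ Symb.uStar) x.1 *
        f m (a ∘ Symb.v) (a ∘ γ ∘ Symb.v) (a ∘ γ ∘ Symb.vStar) (a ∘ Symb.vStar) x.2
          ∂((haarUN N).prod (haarUN N)) = _ := fun a =>
    (integral_prod_mul _ _).trans (congrArg₂ (· * ·)
      (integral_entry_products hn _ _ _ _) (integral_entry_products hm _ _ _ _))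
  simp only [htr]
  rw [integral_finsetSum _ fun a _ => (hf _ _ _ _ _).mul_prod (hf _ _ _ _ _)]
  simp only [hprod, Finset.sum_mul]
  simp only [Finset.mul_sum]
  rw [Finset.sum_comm]
  refine Finset.sum_congr rfl fun σu _ => ?_
  rw [Finset.sum_comm]
  refine Finset.sum_congr rfl fun θu _ => ?_
  rw [Finset.sum_comm]
  refine Finset.sum_congr rfl fun σv _ => ?_
  rw [Finset.sum_comm]
  refine Finset.sum_congr rfl fun θv _ => ?_
  rw [← Nat.cast_pow, ← card_filter_genRel, Finset.card_filter, Nat.cast_sum, Finset.mul_sum]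
  refine Finset.sum_congr rfl fun a _ => ?_
  rw [mul_mul_mul_comm, mul_ite_zero, mul_one, ← ite_and, Nat.cast_ite, Nat.cast_one, Nat.cast_zero]
  simp only [and_comm]

theorem mainTheorem2 (N p : ℕ) (w : Fin p → FreeGroup (Fin 2)) (hw : ∀ k, w k ≠ 1) :
    (letterCount w (0, true) ≠ letterCount w (0, false) ∨
        letterCount w (1, true) ≠ letterCount w (1, false) →
      ∫ x, traceProd w x ∂((haarUN N).prod (haarUN N)) = 0) ∧
    ∀ n m : ℕ,
      letterCount w (0, true) = n → letterCount w (0, false) = n →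
      letterCount w (1, true) = m → letterCount w (1, false) = m →
      n < N → m < N →
      IsUnit (PhiElt N n) ∧ IsUnit (PhiElt N m) ∧
      ∀ e : Indexing w n m,
        (∀ x : UN N × UN N, traceProd w x = traceGamma e.gamma x) ∧
        ∫ x, traceProd w x ∂((haarUN N).prod (haarUN N)) =
          ∑ σu : Equiv.Perm (Fin n), ∑ θu : Equiv.Perm (Fin n),
          ∑ σv : Equiv.Perm (Fin m), ∑ θv : Equiv.Perm (Fin m),
            weingarten N (σu * θu⁻¹) * weingarten N (σv * θv⁻¹) *
              (N : ℂ) ^ numClasses e.gamma σu θu σv θv := by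
  refine ⟨fun h => h.elim (integral_traceProd_eq_zero w hw 0) (integral_traceProd_eq_zero w hw 1),
    fun n m _ _ _ _ hn hm => ⟨isUnit_PhiElt hn.le, isUnit_PhiElt hm.le, fun e =>
      ⟨traceProd_eq_traceGamma w hw e, ?_⟩⟩⟩
  simp only [traceProd_eq_traceGamma w hw e]
  exact integral_traceGamma hn.le hm.le e.gamma
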